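/- Let $n\ge 2$ and $M\ge 2$ be integers, let $s\in[-1,1)$, and let $h:[-1,1)\to\mathbb{R}$. Let $P_i^{(n)}$, $i\ge 0$, be the Gegenbauer polynomials given by $P_0^{(n)}(t)=1$, $P_1^{(n)}(t)=t$ and $(i+n-2)P_{i+1}^{(n)}(t)=(2i+n-2)\,t\,P_i^{(n)}(t)-i\,P_{i-1}^{(n)}(t)$ for $i\ge 1$ (so $P_i^{(n)}(1)=1$). For $f\in C([-1,1])$ let $$f_i=\frac{\int_{-1}^1 f(t)P_i^{(n)}(t)(1-t^2)^{(n-3)/2}\,dt}{\int_{-1}^1 \bigl[P_i^{(n)}(t)\bigr]^2(1-t^2)^{(n-3)/2}\,dt},\qquad i\ge 0,$$ be the coefficients of its Gegenbauer expansion $f=\sum_{i\ge 0} f_iP_i^{(n)}$. Let $U_h^{n,s}$ be the set of all $f\in C([-1,1])$ such that $f(t)\ge h(t)$ for all $t\in[-1,s]$ and $f_i\le 0$ for all $i\ge 1$. Let $C(n,M,s)$ be the set of all $C\subset\mathbb{S}^{n-1}\subset\mathbb{R}^n$ with $|C|=M$ and $\max\{\langle x,y\rangle: x,y\in C,\ x\ne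 y\}=s$. For a finite set $C\subset\mathbb{S}^{n-1}$ put $$E_h(C)=\sum_{x,y\in C,\ x\neq y} h(\langle x,y\rangle),\qquad M_i(C)=\sum_{x,y\in C}P_i^{(n)}(\langle x,y\rangle),$$ and let $\mathcal{G}_h(n,M,s)=\sup\{E_h(C): C\in C(n,M,s)\}$, the supremum being taken in $[-\infty,+\infty]$. If $f\in U_h^{n,s}$ and $C\in C(n,M,s)$, then $$E_h(C)\le \mathcal{G}_h(n,M,s)\le M\,(f_0M-f(1)).$$ Moreover, equality holds throughout, that is, $E_h(C)=\mathcal{G}_h(n,M,s)=M(f_0M-f(1))$, if and only if both of the following conditions hold: (a) $f(t)=h(t)$ for every $t\in\{\langle x,y\rangle: x,y\in C,\ x\neq y\}$; (b) $f_iM_i(C)=0$ for all $i\ge 1$. -/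

import Mathlib

/-- The Gegenbauer polynomials `P_i^{(n)}`, normalized by `P_i^{(n)}(1) = 1`, given by
`(i + n - 2) P_{i+1} = (2 i + n - 2) t P_i - i P_{i-1}` for `i ≥ 1`, `P_0 = 1`, `P_1 = t`
(the recurrence is used for `n ≥ 2`, where `i + n - 2 ≠ 0` for all `i ≥ 1`). -/
noncomputable def gegenbauerPoly (n : ℕ) : ℕ → Polynomial ℝ
  | 0 => 1
  | 1 => Polynomial.X
  | (j + 2) =>
      Polynomial.C (((j : ℝ) + 1 + n - 2)⁻¹) *
        (Polynomial.C (2 * ((j : ℝ) + 1) + n - 2) * Polynomial.X * gegenbauerPoly n (j + 1)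
          - Polynomial.C ((j : ℝ) + 1) * gegenbauerPoly n j)

/-- The weight `(1 - t^2)^{(n-3)/2}` on `[-1,1]`. -/
noncomputable def gegenbauerWeight (n : ℕ) (t : ℝ) : ℝ :=
  (1 - t ^ 2) ^ (((n : ℝ) - 3) / 2)

/-- The `i`-th coefficient `f_i` of the Gegenbauer expansion `f = ∑ f_i P_i^{(n)}`:
`f_i = (∫ f P_i w) / (∫ P_i^2 w)` with the integrals over `[-1,1]`. -/
noncomputable def gegenbauerCoeff (n : ℕ) (f : ℝ → ℝ) (i : ℕ) : ℝ :=
  (∫ t in (-1 : ℝ)..1, f t * (gegenbauerPoly n i).eval t * gegenbauerWeight n t) /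
    (∫ t in (-1 : ℝ)..1, ((gegenbauerPoly n i).eval t) ^ 2 * gegenbauerWeight n t)

/-- The set of inner products `⟨x, y⟩` of distinct points `x ≠ y` of `C`. -/
def innerProducts {n : ℕ} (C : Finset (EuclideanSpace ℝ (Fin n))) : Set ℝ :=
  {t | ∃ x ∈ C, ∃ y ∈ C, x ≠ y ∧ inner ℝ x y = t}

/-- `C(n, M, s)`: the codes on the unit sphere of `ℝⁿ` with `M` points whose maximal inner
product of two distinct points is `s`. -/
def sphericalCodes (n M : ℕ) (s : ℝ) : Set (Finset (EuclideanSpace ℝ (Fin n))) :=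
  {C | (∀ x ∈ C, x ∈ Metric.sphere (0 : EuclideanSpace ℝ (Fin n)) 1) ∧
    C.card = M ∧ IsGreatest (innerProducts C) s}

open Classical in
/-- The (unnormalized) `h`-energy: the sum of `h ⟨x, y⟩` over ordered pairs `x ≠ y` in `C`.
For points on the unit sphere only the values of `h` on `[-1,1)` enter. -/
noncomputable def hEnergy {n : ℕ} (h : ℝ → ℝ) (C : Finset (EuclideanSpace ℝ (Fin n))) : ℝ :=
  ∑ p ∈ C.offDiag, h (inner ℝ p.1 p.2)

/-- `G_h(n, M, s)`: the supremum of the `h`-energy over `C(n, M, s)`, in the extended reals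
(so it is `-∞` if there are no such codes). -/
noncomputable def maxEnergy (h : ℝ → ℝ) (n M : ℕ) (s : ℝ) : EReal :=
  ⨆ C ∈ sphericalCodes n M s, ((hEnergy h C : ℝ) : EReal)

/-- The feasible set `U_h^{n,s}`: functions continuous on `[-1,1]` with `f ≥ h` on `[-1,s]` and
with nonpositive Gegenbauer coefficients `f_i` for all `i ≥ 1`. -/
def feasibleSet (h : ℝ → ℝ) (n : ℕ) (s : ℝ) : Set (ℝ → ℝ) :=
  {f | ContinuousOn f (Set.Icc (-1) 1) ∧ (∀ t ∈ Set.Icc (-1) s, h t ≤ f t) ∧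
    ∀ i : ℕ, 1 ≤ i → gegenbauerCoeff n f i ≤ 0}

/-- The `i`-th moment of `C`: the sum of `P_i^{(n)}(⟨x, y⟩)` over all ordered pairs in `C`
(including `x = y`). -/
noncomputable def codeMoment {n : ℕ} (C : Finset (EuclideanSpace ℝ (Fin n))) (i : ℕ) : ℝ :=
  ∑ x ∈ C, ∑ y ∈ C, (gegenbauerPoly n i).eval (inner ℝ x y)

/-! Summing the expansion of `f` over all pairs in a code `C` of `M` unit vectors gives `E_f(C) + M
f(1) = f_0 M² + ∑_{i≥1} f_i M_i(C)`. The moments are nonnegative and `f_i ≤ 0` for `i ≥ 1`, so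
`E_h(C) ≤ E_f(C) ≤ M (f_0 M - f(1))`. The first inequality is an equality exactly when `f = h` on
the inner products, the second exactly when every `f_i M_i(C)` vanishes. Two analytic facts carry
this.

Positive definiteness (`gegenbauerPoly_posDef`): in the Fischer inner product, multiplication by
`‖x‖²` is adjoint to the Laplacian and powers of linear forms reproduce values. A zonal harmonic is
harmonic and equals a positive multiple of `⟨x, y⟩^k` modulo `‖x‖²`, so pairing two of them gives a
positive constant times `P_k(⟨y, y'⟩)`. The kernel is thus a Gram matrix.

Convergence (`hasSum_gegenbauerCoeff`): `f` is only continuous, so the signs of the `f_i` must be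
exploited. Powers of a peak function form an approximate identity. Together with the nonnegative
three-term recurrence, this shows that nonnegative coefficients force a nonnegative value at `1`.
Applied to partial sums minus `f`, it bounds `∑ |f_i|`. Since `|P_i| ≤ 1`, the series converges
uniformly, and a second peak argument identifies its sum with `f`. -/

open scoped Nat in
/-- The Fischer inner product `⟪p, q⟫ = ∑ m! pₘ qₘ` on polynomials in several variables. -/
noncomputable def fischerForm (σ : Type*) [Fintype σ] :
    MvPolynomial σ ℝ →ₗ[ℝ] MvPolynomial σ ℝ →ₗ[ℝ] ℝ :=
  (MvPolynomial.basisMonomials σ ℝ).constr ℝ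
    fun m => ((∏ i, (m i)! : ℕ) : ℝ) • MvPolynomial.lcoeff ℝ m

/-! ### Fischer inner product and differential operators -/

section Fischer

open MvPolynomial Finset
open scoped Nat

variable {σ : Type*} [Fintype σ]

theorem fischerForm_monomial (m : σ →₀ ℕ) (a : ℝ) (q : MvPolynomial σ ℝ) :
    fischerForm σ (monomial m a) q = a * (((∏ i, (m i)! : ℕ) : ℝ) * coeff m q) := by
  have h : monomial m a = a • basisMonomials σ ℝ m := by
    simp [coe_basisMonomials, smul_monomial]
  rw [h, map_smul, fischerForm, Module.Basis.constr_basis]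
  simp [lcoeff_apply]

theorem fischerForm_self_nonneg (p : MvPolynomial σ ℝ) : 0 ≤ fischerForm σ p p := by
  have h : fischerForm σ p p = ∑ m ∈ p.support, fischerForm σ (monomial m (coeff m p)) p := by
    rw [← LinearMap.sum_apply, ← map_sum, ← p.as_sum]
  rw [h]
  refine sum_nonneg fun m _ => ?_
  rw [fischerForm_monomial]
  have := mul_nonneg (Nat.cast_nonneg (α := ℝ) (∏ i, (m i)!)) (mul_self_nonneg (coeff m p))
  linarith

/-- The factorial weights are chosen for this adjointness: raising the `i`-th exponent multiplies
the weight by `m i + 1`, which is the factor produced by differentiation. -/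
theorem fischerForm_X_mul (i : σ) (p q : MvPolynomial σ ℝ) :
    fischerForm σ (X i * p) q = fischerForm σ p (pderiv i q) := by
  classical
  induction p using MvPolynomial.induction_on' with
  | add p₁ p₂ h₁ h₂ => simp [mul_add, h₁, h₂]
  | monomial m a =>
    have h : (X i : MvPolynomial σ ℝ) * monomial m a = monomial (m + Finsupp.single i 1) a := by
      rw [X, monomial_mul, one_mul, add_comm]
    rw [h, fischerForm_monomial, fischerForm_monomial, coeff_pderiv]
    have h₂ : (∏ j, ((m + Finsupp.single i 1 : σ →₀ ℕ) j)!) = (m i + 1) * ∏ j, (m j)! := by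
      rw [← mul_prod_erase univ _ (mem_univ i),
        ← mul_prod_erase univ (fun j => (m j)!) (mem_univ i)]
      have h₃ : ∀ j ∈ univ.erase i, ((m + Finsupp.single i 1 : σ →₀ ℕ) j)! = (m j)! := by
        intro j hj
        simp [(ne_of_mem_erase hj).symm]
      rw [prod_congr rfl h₃]
      simp [Nat.factorial_succ, mul_assoc]
    rw [h₂]
    push_cast
    ring

/-- The derivative of a polynomial in the direction `y`. -/
noncomputable def directionalDeriv (y : σ → ℝ) :
    Derivation ℝ (MvPolynomial σ ℝ) (MvPolynomial σ ℝ) :=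
  ∑ i, y i • pderiv i

/-- The linear form `x ↦ ∑ i, y i * x i`. -/
noncomputable def linForm (y : σ → ℝ) : MvPolynomial σ ℝ := ∑ i, C (y i) * X i

/-- The quadratic form `x ↦ ∑ i, (x i) ^ 2`. -/
noncomputable def normSqPoly (σ : Type*) [Fintype σ] : MvPolynomial σ ℝ := ∑ i, X i * X i

/-- The Laplace operator on polynomials. -/
noncomputable def polyLaplacian (σ : Type*) [Fintype σ] :
    MvPolynomial σ ℝ →ₗ[ℝ] MvPolynomial σ ℝ :=
  ∑ i, (pderiv i).toLinearMap ∘ₗ (pderiv i).toLinearMap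

theorem directionalDeriv_apply (y : σ → ℝ) (p : MvPolynomial σ ℝ) :
    directionalDeriv y p = ∑ i, C (y i) * pderiv i p := by
  have h : directionalDeriv y p = ∑ i, (y i • pderiv i) p := by
    rw [directionalDeriv, ← Derivation.coeFnAddMonoidHom_apply, map_sum, Finset.sum_apply]
    rfl
  rw [h]
  exact sum_congr rfl fun i _ => by rw [Derivation.smul_apply, smul_eq_C_mul]

theorem polyLaplacian_apply (p : MvPolynomial σ ℝ) :
    polyLaplacian σ p = ∑ i, pderiv i (pderiv i p) := by
  simp [polyLaplacian]

theorem polyLaplacian_mul (p q : MvPolynomial σ ℝ) :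
    polyLaplacian σ (p * q) = polyLaplacian σ p * q + 2 * ∑ i, pderiv i p * pderiv i q +
      p * polyLaplacian σ q := by
  simp only [polyLaplacian_apply, pderiv_mul, map_add, sum_mul, mul_sum, ← sum_add_distrib]
  exact sum_congr rfl fun i _ => by ring

theorem polyLaplacian_C_mul (a : ℝ) (p : MvPolynomial σ ℝ) :
    polyLaplacian σ (C a * p) = C a * polyLaplacian σ p := by
  rw [← smul_eq_C_mul, map_smul, smul_eq_C_mul]

theorem directionalDeriv_C_mul (y : σ → ℝ) (a : ℝ) (p : MvPolynomial σ ℝ) :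
    directionalDeriv y (C a * p) = C a * directionalDeriv y p := by
  rw [← smul_eq_C_mul, Derivation.map_smul, smul_eq_C_mul]

theorem pderiv_linForm (y : σ → ℝ) (i : σ) : pderiv i (linForm y) = C (y i) := by
  classical
  simp [linForm, pderiv_X, Pi.single_apply]

theorem pderiv_normSqPoly (i : σ) : pderiv i (normSqPoly σ) = 2 * X i := by
  classical
  simp [normSqPoly, pderiv_X, Pi.single_apply, sum_add_distrib, two_mul]

theorem polyLaplacian_linForm (y : σ → ℝ) : polyLaplacian σ (linForm y) = 0 := by
  simp [polyLaplacian_apply, pderiv_linForm]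

theorem polyLaplacian_normSqPoly :
    polyLaplacian σ (normSqPoly σ) = C (2 * (Fintype.card σ : ℝ)) := by
  have h (i : σ) : pderiv i (2 * X i : MvPolynomial σ ℝ) = C 2 := by
    rw [show (2 : MvPolynomial σ ℝ) = C 2 from (map_ofNat C 2).symm, pderiv_C_mul, pderiv_X_self,
      mul_one]
  simp only [polyLaplacian_apply, pderiv_normSqPoly, h, sum_const, card_univ, nsmul_eq_mul]
  rw [mul_comm, C_mul]
  simp

theorem directionalDeriv_linForm (y : σ → ℝ) :
    directionalDeriv y (linForm y) = C (∑ i, y i * y i) := by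
  simp [directionalDeriv_apply, pderiv_linForm]

theorem directionalDeriv_normSqPoly (y : σ → ℝ) :
    directionalDeriv y (normSqPoly σ) = 2 * linForm y := by
  simp only [directionalDeriv_apply, pderiv_normSqPoly, linForm, mul_sum]
  exact sum_congr rfl fun i _ => by ring

theorem polyLaplacian_linForm_mul (y : σ → ℝ) (p : MvPolynomial σ ℝ) :
    polyLaplacian σ (linForm y * p) = 2 * directionalDeriv y p + linForm y * polyLaplacian σ p := by
  rw [polyLaplacian_mul, polyLaplacian_linForm, directionalDeriv_apply]
  simp [pderiv_linForm]

theorem polyLaplacian_normSqPoly_mul {k : ℕ} {p : MvPolynomial σ ℝ} (hp : p.IsHomogeneous k) :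
    polyLaplacian σ (normSqPoly σ * p) = C (2 * (Fintype.card σ : ℝ) + 4 * k) * p +
      normSqPoly σ * polyLaplacian σ p := by
  have h : ∑ i, pderiv i (normSqPoly σ) * pderiv i p = 2 * (k : MvPolynomial σ ℝ) * p := by
    rw [mul_assoc, ← nsmul_eq_mul, ← hp.sum_X_mul_pderiv, mul_sum]
    exact sum_congr rfl fun i _ => by rw [pderiv_normSqPoly]; ring
  rw [polyLaplacian_mul, polyLaplacian_normSqPoly, h]
  simp only [map_add, map_mul, map_natCast, map_ofNat]
  ring

theorem isHomogeneous_linForm (y : σ → ℝ) : (linForm y).IsHomogeneous 1 :=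
  IsHomogeneous.sum _ _ _ fun i _ => by
    simpa using (isHomogeneous_C σ (y i)).mul (isHomogeneous_X ℝ i)

theorem isHomogeneous_normSqPoly : (normSqPoly σ).IsHomogeneous 2 :=
  IsHomogeneous.sum _ _ _ fun i _ => by
    simpa using (isHomogeneous_X ℝ i).mul (isHomogeneous_X ℝ i)

theorem fischerForm_linForm_mul (y : σ → ℝ) (p q : MvPolynomial σ ℝ) :
    fischerForm σ (linForm y * p) q = fischerForm σ p (directionalDeriv y q) := by
  simp only [linForm, directionalDeriv_apply, sum_mul, map_sum, LinearMap.sum_apply,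
    ← smul_eq_C_mul, smul_mul_assoc, map_smul, LinearMap.smul_apply, fischerForm_X_mul]

/-- Consequently multiples of `‖x‖²` are orthogonal to harmonic polynomials. -/
theorem fischerForm_normSqPoly_mul (p q : MvPolynomial σ ℝ) :
    fischerForm σ (normSqPoly σ * p) q = fischerForm σ p (polyLaplacian σ q) := by
  simp only [normSqPoly, polyLaplacian_apply, sum_mul, map_sum, LinearMap.sum_apply, mul_assoc,
    fischerForm_X_mul]

theorem eval_directionalDeriv {k : ℕ} (y : σ → ℝ) {p : MvPolynomial σ ℝ}
    (hp : p.IsHomogeneous k) : eval y (directionalDeriv y p) = k * eval y p := by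
  have h := congrArg (eval y) hp.sum_X_mul_pderiv
  simpa [directionalDeriv_apply] using h

theorem isHomogeneous_directionalDeriv {k : ℕ} (y : σ → ℝ) {p : MvPolynomial σ ℝ}
    (hp : p.IsHomogeneous (k + 1)) : (directionalDeriv y p).IsHomogeneous k := by
  rw [directionalDeriv_apply]
  refine IsHomogeneous.sum _ _ _ fun i _ => ?_
  simpa using (isHomogeneous_C σ (y i)).mul (hp.pderiv (i := i))

/-- Powers of linear forms reproduce homogeneous polynomials. -/
theorem fischerForm_linForm_pow (y : σ → ℝ) (k : ℕ) {p : MvPolynomial σ ℝ}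
    (hp : p.IsHomogeneous k) : fischerForm σ (linForm y ^ k) p = (k)! * eval y p := by
  induction k generalizing p with
  | zero =>
    obtain ⟨a, rfl⟩ : ∃ a, p = C a :=
      ⟨_, totalDegree_eq_zero_iff_eq_C.1 (Nat.le_zero.1 hp.totalDegree_le)⟩
    have := fischerForm_monomial (0 : σ →₀ ℕ) 1 (C a)
    simpa using this
  | succ k ih =>
    -- One linear factor crosses over as a derivative along `y`; Euler's identity at `y` turns it
    -- into the factor `k + 1` of the factorial.
    rw [pow_succ', fischerForm_linForm_mul, ih (isHomogeneous_directionalDeriv y hp),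
      eval_directionalDeriv y hp, Nat.factorial_succ]
    push_cast
    ring

end Fischer

/-! ### Zonal harmonics and positive definiteness -/

section Zonal

open MvPolynomial Finset
open scoped Nat

/-- The zonal harmonic of degree `k` with pole `y`: the homogeneous polynomial
`‖x‖ ^ k * P_k^{(n)}(⟨x, y⟩ / ‖x‖)`. -/
noncomputable def zonalHarmonic {n : ℕ} (y : Fin n → ℝ) : ℕ → MvPolynomial (Fin n) ℝ
  | 0 => 1
  | 1 => linForm y
  | (j + 2) =>
      C (((j : ℝ) + 1 + n - 2)⁻¹) *
        (C (2 * ((j : ℝ) + 1) + n - 2) * linForm y * zonalHarmonic y (j + 1)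
          - C ((j : ℝ) + 1) * normSqPoly (Fin n) * zonalHarmonic y j)

variable {n : ℕ}

theorem add_one_add_sub_two_pos (hn : 2 ≤ n) (j : ℕ) : (0 : ℝ) < (j : ℝ) + 1 + n - 2 := by
  have : (2 : ℝ) ≤ n := by exact_mod_cast hn
  have : (0 : ℝ) ≤ j := Nat.cast_nonneg j
  linarith

theorem zonalHarmonic_recurrence (hn : 2 ≤ n) (y : Fin n → ℝ) (j : ℕ) :
    C ((j : ℝ) + 1 + n - 2) * zonalHarmonic y (j + 2) =
      C (2 * ((j : ℝ) + 1) + n - 2) * (linForm y * zonalHarmonic y (j + 1))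
          - C ((j : ℝ) + 1) * (normSqPoly (Fin n) * zonalHarmonic y j) := by
  rw [zonalHarmonic, ← mul_assoc, ← C_mul,
    mul_inv_cancel₀ (add_one_add_sub_two_pos hn j).ne', C_1]
  ring

theorem isHomogeneous_zonalHarmonic (y : Fin n → ℝ) (k : ℕ) :
    (zonalHarmonic y k).IsHomogeneous k := by
  induction k using Nat.twoStepInduction with
  | zero => simpa [zonalHarmonic] using isHomogeneous_one (Fin n) ℝ
  | one => simpa [zonalHarmonic] using isHomogeneous_linForm y
  | more j ih₀ ih₁ =>
    rw [zonalHarmonic]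
    have h₁ := ((isHomogeneous_C (Fin n) (2 * ((j : ℝ) + 1) + n - 2)).mul
      (isHomogeneous_linForm y)).mul ih₁
    have h₀ := ((isHomogeneous_C (Fin n) ((j : ℝ) + 1)).mul
      (isHomogeneous_normSqPoly (σ := Fin n))).mul ih₀
    have e₁ : 0 + 1 + (j + 1) = j + 2 := by ring
    have e₀ : 0 + 2 + j = j + 2 := by ring
    rw [e₁] at h₁
    rw [e₀] at h₀
    simpa using (isHomogeneous_C (Fin n) (((j : ℝ) + 1 + n - 2)⁻¹)).mul (h₁.sub h₀)

theorem C_mul_left_cancel {σ : Type*} {a : ℝ} (ha : a ≠ 0) {p q : MvPolynomial σ ℝ}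
    (h : C a * p = C a * q) : p = q := by
  have h' := congrArg (C a⁻¹ * ·) h
  simpa [← mul_assoc, ← C_mul, inv_mul_cancel₀ ha] using h'

/-- Differentiate the recurrence along the pole. In the inductive step, the recurrence one level
lower eliminates the remaining `‖x‖²` term. -/
theorem directionalDeriv_zonalHarmonic (hn : 2 ≤ n) {y : Fin n → ℝ} (hy : ∑ i, y i * y i = 1)
    (k : ℕ) : directionalDeriv y (zonalHarmonic y (k + 1)) =
      C ((k : ℝ) + 1) * zonalHarmonic y k := by
  have hl : directionalDeriv y (linForm y) = 1 := by rw [directionalDeriv_linForm, hy, C_1]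
  induction k using Nat.twoStepInduction with
  | zero => simp [zonalHarmonic, hl]
  | one =>
    refine C_mul_left_cancel (add_one_add_sub_two_pos hn 0).ne' ?_
    rw [← directionalDeriv_C_mul, zonalHarmonic_recurrence hn, map_sub, directionalDeriv_C_mul,
      directionalDeriv_C_mul, Derivation.leibniz, Derivation.leibniz, directionalDeriv_normSqPoly]
    simp only [zonalHarmonic, hl, smul_eq_mul, Derivation.map_one_eq_zero]
    simp only [map_add, map_sub, map_mul, map_natCast, map_ofNat, map_one]
    push_cast
    ring
  | more j ih₀ ih₁ =>
    refine C_mul_left_cancel (add_one_add_sub_two_pos hn (j + 1)).ne' ?_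
    have hr := zonalHarmonic_recurrence hn y j
    rw [← directionalDeriv_C_mul, zonalHarmonic_recurrence hn, map_sub, directionalDeriv_C_mul,
      directionalDeriv_C_mul, Derivation.leibniz, Derivation.leibniz, directionalDeriv_normSqPoly,
      ih₀, ih₁, hl]
    simp only [smul_eq_mul, map_add, map_sub, map_mul, map_natCast, map_ofNat, map_one] at hr ⊢
    push_cast at hr ⊢
    linear_combination (-(j : MvPolynomial (Fin n) ℝ) - 2) * hr

/-- The Laplacian of the recurrence leaves only multiples of the harmonic of degree `j`, and these
cancel: `(2j + n) · 2(j + 1) = (j + 1)(2n + 4j)`. -/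
theorem polyLaplacian_zonalHarmonic (hn : 2 ≤ n) {y : Fin n → ℝ} (hy : ∑ i, y i * y i = 1)
    (k : ℕ) : polyLaplacian (Fin n) (zonalHarmonic y k) = 0 := by
  induction k using Nat.twoStepInduction with
  | zero => simp [zonalHarmonic, polyLaplacian_apply]
  | one => simp [zonalHarmonic, polyLaplacian_linForm]
  | more j ih₀ ih₁ =>
    refine C_mul_left_cancel (add_one_add_sub_two_pos hn j).ne' ?_
    rw [← polyLaplacian_C_mul, zonalHarmonic_recurrence hn, map_sub, polyLaplacian_C_mul,
      polyLaplacian_C_mul, polyLaplacian_linForm_mul,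
      polyLaplacian_normSqPoly_mul (isHomogeneous_zonalHarmonic y j), ih₀, ih₁,
      directionalDeriv_zonalHarmonic hn hy]
    simp only [map_add, map_sub, map_mul, map_natCast, map_ofNat, map_one, Fintype.card_fin]
    ring

/-- A zonal harmonic is a positive multiple of a power of a linear form, modulo `‖x‖ ^ 2`. -/
theorem exists_zonalHarmonic_eq (hn : 2 ≤ n) (k : ℕ) :
    ∃ c : ℝ, 0 < c ∧ ∀ y : Fin n → ℝ, ∃ q : MvPolynomial (Fin n) ℝ,
      zonalHarmonic y k = C c * linForm y ^ k + normSqPoly (Fin n) * q := by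
  induction k using Nat.twoStepInduction with
  | zero => exact ⟨1, one_pos, fun y => ⟨0, by simp [zonalHarmonic]⟩⟩
  | one => exact ⟨1, one_pos, fun y => ⟨0, by simp [zonalHarmonic]⟩⟩
  | more j _ ih₁ =>
    obtain ⟨c, hc, h⟩ := ih₁
    have h₁ := add_one_add_sub_two_pos hn j
    have h₂ : (0 : ℝ) < 2 * ((j : ℝ) + 1) + n - 2 := by
      have : (0 : ℝ) ≤ j := Nat.cast_nonneg j
      linarith
    refine ⟨((j : ℝ) + 1 + n - 2)⁻¹ * (2 * ((j : ℝ) + 1) + n - 2) * c, by positivity,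
      fun y => ?_⟩
    obtain ⟨q, hq⟩ := h y
    refine ⟨C (((j : ℝ) + 1 + n - 2)⁻¹) * (C (2 * ((j : ℝ) + 1) + n - 2) * linForm y * q
      - C ((j : ℝ) + 1) * zonalHarmonic y j), ?_⟩
    rw [zonalHarmonic, hq, C_mul, C_mul]
    ring

theorem eval_zonalHarmonic (y : Fin n → ℝ) {x : Fin n → ℝ} (hx : ∑ i, x i * x i = 1) (k : ℕ) :
    eval x (zonalHarmonic y k) = (gegenbauerPoly n k).eval (∑ i, y i * x i) := by
  induction k using Nat.twoStepInduction with
  | zero => simp [zonalHarmonic, gegenbauerPoly]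
  | one => simp [zonalHarmonic, gegenbauerPoly, linForm]
  | more j ih₀ ih₁ =>
    rw [zonalHarmonic, gegenbauerPoly]
    simp only [map_mul, map_sub, eval_C, ih₀, ih₁, Polynomial.eval_mul, Polynomial.eval_sub,
      Polynomial.eval_C, Polynomial.eval_X]
    simp [linForm, normSqPoly, hx]

/-- Gegenbauer polynomials are positive definite functions on the sphere. -/
theorem gegenbauerPoly_posDef (hn : 2 ≤ n) (k : ℕ) {ι : Type*} (s : Finset ι) (c : ι → ℝ)
    (v : ι → EuclideanSpace ℝ (Fin n)) (hv : ∀ a ∈ s, ‖v a‖ = 1) :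
    0 ≤ ∑ a ∈ s, ∑ b ∈ s, c a * c b * (gegenbauerPoly n k).eval (inner ℝ (v a) (v b)) := by
  have hinner (x y : EuclideanSpace ℝ (Fin n)) : inner ℝ x y = ∑ i, x i * y i := by
    simp [PiLp.inner_apply, mul_comm]
  have hv' (a : ι) (ha : a ∈ s) : ∑ i, (v a).ofLp i * (v a).ofLp i = 1 := by
    rw [← hinner, real_inner_self_eq_norm_sq, hv a ha, one_pow]
  obtain ⟨d, hd, hz⟩ := exists_zonalHarmonic_eq hn k
  have key (a : ι) (ha : a ∈ s) (b : ι) (hb : b ∈ s) :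
      fischerForm (Fin n) (zonalHarmonic (v a).ofLp k) (zonalHarmonic (v b).ofLp k) =
        d * (k)! * (gegenbauerPoly n k).eval (inner ℝ (v a) (v b)) := by
    obtain ⟨q, hq⟩ := hz (v a).ofLp
    -- The `‖x‖² q` part pairs to zero with a harmonic polynomial; the power of the linear form
    -- evaluates the other zonal harmonic at `v a`.
    rw [hq, map_add, LinearMap.add_apply, fischerForm_normSqPoly_mul,
      polyLaplacian_zonalHarmonic hn (hv' b hb), map_zero, add_zero, ← smul_eq_C_mul, map_smul,
      LinearMap.smul_apply, fischerForm_linForm_pow _ _ (isHomogeneous_zonalHarmonic _ k),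
      eval_zonalHarmonic _ (hv' a ha), ← hinner, real_inner_comm, smul_eq_mul]
    ring
  have h := fischerForm_self_nonneg (∑ a ∈ s, c a • zonalHarmonic (v a).ofLp k)
  have hsum : fischerForm (Fin n) (∑ a ∈ s, c a • zonalHarmonic (v a).ofLp k)
      (∑ a ∈ s, c a • zonalHarmonic (v a).ofLp k) = d * (k)! *
        ∑ a ∈ s, ∑ b ∈ s, c a * c b * (gegenbauerPoly n k).eval (inner ℝ (v a) (v b)) := by
    simp only [map_sum, map_smul, LinearMap.sum_apply, LinearMap.smul_apply, smul_eq_mul, mul_sum]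
    rw [sum_comm]
    refine sum_congr rfl fun a ha => sum_congr rfl fun b hb => ?_
    rw [key a ha b hb]
    ring
  rw [hsum] at h
  exact nonneg_of_mul_nonneg_right h (by positivity)

end Zonal

/-! ### Gegenbauer polynomials: bounds and identities -/

section GegenbauerMeasure

open MeasureTheory Set Polynomial
open scoped ENNReal

variable {n : ℕ}

theorem gegenbauerPoly_recurrence (hn : 2 ≤ n) (j : ℕ) :
    C ((j : ℝ) + 1 + n - 2) * gegenbauerPoly n (j + 2) =
      C (2 * ((j : ℝ) + 1) + n - 2) * X * gegenbauerPoly n (j + 1)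
          - C ((j : ℝ) + 1) * gegenbauerPoly n j := by
  rw [gegenbauerPoly, ← mul_assoc, ← C_mul,
    mul_inv_cancel₀ (add_one_add_sub_two_pos hn j).ne', C_1, one_mul]

theorem gegenbauerPoly_eval_one (hn : 2 ≤ n) (k : ℕ) : (gegenbauerPoly n k).eval 1 = 1 := by
  induction k using Nat.twoStepInduction with
  | zero => simp [gegenbauerPoly]
  | one => simp [gegenbauerPoly]
  | more j ih₀ ih₁ =>
    have h := congrArg (eval 1) (gegenbauerPoly_recurrence hn j)
    simp only [eval_mul, eval_sub, eval_C, eval_X, ih₀, ih₁] at h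
    exact mul_left_cancel₀ (add_one_add_sub_two_pos hn j).ne' (by linarith)

/-- Gegenbauer polynomials are bounded by `1` on `[-1, 1]`. -/
theorem abs_gegenbauerPoly_eval_le_one (hn : 2 ≤ n) (k : ℕ) {t : ℝ} (ht : t ∈ Icc (-1 : ℝ) 1) :
    |(gegenbauerPoly n k).eval t| ≤ 1 := by
  let i₀ : Fin n := ⟨0, by omega⟩
  let i₁ : Fin n := ⟨1, by omega⟩
  have hi : i₀ ≠ i₁ := by simp [i₀, i₁]
  have ht' : 0 ≤ 1 - t ^ 2 := by nlinarith [ht.1, ht.2]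
  let x : EuclideanSpace ℝ (Fin n) := EuclideanSpace.single i₀ 1
  let y : EuclideanSpace ℝ (Fin n) :=
    EuclideanSpace.single i₀ t + EuclideanSpace.single i₁ (Real.sqrt (1 - t ^ 2))
  have hxx : inner ℝ x x = (1 : ℝ) := by simp [x]
  have hxy : inner ℝ x y = t := by
    simp [x, y, inner_add_right, EuclideanSpace.inner_single_left, hi]
  have hyy : inner ℝ y y = (1 : ℝ) := by
    simp only [y, inner_add_right, inner_add_left, EuclideanSpace.inner_single_left]
    simp [hi, hi.symm, Real.mul_self_sqrt ht']
    ring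
  have hx : ‖x‖ = 1 := by
    rw [real_inner_self_eq_norm_sq] at hxx
    exact (pow_eq_one_iff_of_nonneg (norm_nonneg x) two_ne_zero).1 hxx
  have hy : ‖y‖ = 1 := by
    rw [real_inner_self_eq_norm_sq] at hyy
    exact (pow_eq_one_iff_of_nonneg (norm_nonneg y) two_ne_zero).1 hyy
  -- Two unit vectors at inner product `t` with weights `1, c` give `1 + 2c P_k(t) + c² ≥ 0`; the
  -- choices `c = ±1` yield the bound.
  have h (c : ℝ) := gegenbauerPoly_posDef hn k Finset.univ ![1, c] ![x, y] (by
    intro a _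
    fin_cases a <;> simp [hx, hy])
  simp only [Fin.sum_univ_two, Matrix.cons_val_zero, Matrix.cons_val_one, hxx, hxy,
    real_inner_comm x y, hyy, gegenbauerPoly_eval_one hn] at h
  rw [abs_le]
  constructor
  · have := h 1
    linarith
  · have := h (-1)
    linarith

/-- Needed to feed the integration by parts; the induction differentiates the three-term recurrence.
-/
theorem one_sub_sq_mul_derivative_gegenbauerPoly (hn : 2 ≤ n) (k : ℕ) :
    (1 - X ^ 2) * derivative (gegenbauerPoly n (k + 1)) =
      C ((k : ℝ) + 1) * (gegenbauerPoly n k - X * gegenbauerPoly n (k + 1)) := by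
  have cancel {a : ℝ} (ha : a ≠ 0) {p q : ℝ[X]} (h : C a * p = C a * q) : p = q :=
    mul_left_cancel₀ (C_ne_zero.2 ha) h
  induction k using Nat.twoStepInduction with
  | zero => simp [gegenbauerPoly]; ring
  | one =>
    refine cancel (add_one_add_sub_two_pos hn 0).ne' ?_
    have hr := gegenbauerPoly_recurrence hn 0
    have hd := congrArg derivative hr
    have h₁ : gegenbauerPoly n 1 = X := by simp [gegenbauerPoly]
    have h₀ : gegenbauerPoly n 0 = 1 := by simp [gegenbauerPoly]
    simp only [zero_add, Nat.reduceAdd, h₁, h₀, derivative_mul, derivative_sub,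
      derivative_C, derivative_X, derivative_one] at hr hd ⊢
    simp only [map_add, map_sub, map_mul, map_natCast, map_ofNat, map_one] at hr hd ⊢
    push_cast at hr hd ⊢
    linear_combination (1 - X ^ 2) * hd + 2 * X * hr
  | more j ih₀ ih₁ =>
    refine cancel (add_one_add_sub_two_pos hn (j + 1)).ne' ?_
    have hr₀ := gegenbauerPoly_recurrence hn j
    have hr := gegenbauerPoly_recurrence hn (j + 1)
    have hd := congrArg derivative hr
    simp only [derivative_mul, derivative_sub, derivative_C, derivative_X] at hd
    simp only [map_add, map_sub, map_mul, map_natCast, map_ofNat, map_one]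
      at hr hr₀ hd ih₀ ih₁ ⊢
    push_cast at hr hr₀ hd ih₀ ih₁ ⊢
    linear_combination (1 - X ^ 2) * hd + ((j : ℝ[X]) + 3) * X * hr +
      (2 * ((j : ℝ[X]) + 2) + n - 2) * X * ih₁ - ((j : ℝ[X]) + 2) * ih₀
      - ((j : ℝ[X]) + 2) * hr₀

/-- Three-term recurrence with nonnegative coefficients. -/
theorem exists_X_mul_gegenbauerPoly (hn : 2 ≤ n) (k : ℕ) :
    ∃ a b : ℝ, 0 < a ∧ 0 ≤ b ∧ (0 < k → 0 < b) ∧ X * gegenbauerPoly n k =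
      C a * gegenbauerPoly n (k + 1) + C b * gegenbauerPoly n (k - 1) := by
  cases k with
  -- At degree `0` the coefficient `b = 0` makes the truncated index `k - 1` harmless.
  | zero => exact ⟨1, 0, one_pos, le_rfl, fun h => absurd h (lt_irrefl 0),
      by simp [gegenbauerPoly]⟩
  | succ j =>
    have h₁ := add_one_add_sub_two_pos hn j
    have hj : (0 : ℝ) ≤ j := Nat.cast_nonneg j
    have h₂ : (0 : ℝ) < 2 * ((j : ℝ) + 1) + n - 2 := by linarith
    refine ⟨((j : ℝ) + 1 + n - 2) / (2 * ((j : ℝ) + 1) + n - 2),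
      ((j : ℝ) + 1) / (2 * ((j : ℝ) + 1) + n - 2), by positivity, by positivity,
      fun _ => by positivity, ?_⟩
    refine mul_left_cancel₀ (C_ne_zero.2 h₂.ne') ?_
    rw [mul_add (C _), ← mul_assoc (C _) (C _), ← mul_assoc (C _) (C _), ← C_mul, ← C_mul,
      mul_div_cancel₀ _ h₂.ne', mul_div_cancel₀ _ h₂.ne', gegenbauerPoly_recurrence hn]
    simp only [Nat.add_sub_cancel]
    ring

/-! ### The Gegenbauer weight as a finite measure -/

theorem gegenbauerWeight_pos (n : ℕ) {t : ℝ} (ht : t ∈ Ioo (-1 : ℝ) 1) :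
    0 < gegenbauerWeight n t :=
  Real.rpow_pos_of_pos (by nlinarith [ht.1, ht.2]) _

theorem gegenbauerWeight_nonneg (n : ℕ) {t : ℝ} (ht : t ∈ Icc (-1 : ℝ) 1) :
    0 ≤ gegenbauerWeight n t :=
  Real.rpow_nonneg (by nlinarith [ht.1, ht.2]) _

theorem measurable_gegenbauerWeight (n : ℕ) : Measurable (gegenbauerWeight n) := by
  unfold gegenbauerWeight
  fun_prop

theorem integrableOn_gegenbauerWeight (hn : 2 ≤ n) :
    IntegrableOn (gegenbauerWeight n) (Icc (-1) 1) := by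
  -- The case `n = 2` dominates all others, since `0 < 1 - t² ≤ 1` inside the interval; there the
  -- weight is the derivative of `arcsin`.
  have h : IntegrableOn (fun t : ℝ => 1 / Real.sqrt (1 - t ^ 2)) (Ioc (-1) 1) :=
    intervalIntegral.integrableOn_deriv_of_nonneg Real.continuous_arcsin.continuousOn
      (fun t ht => Real.hasDerivAt_arcsin ht.1.ne' ht.2.ne) fun t _ => by positivity
  rw [integrableOn_Icc_iff_integrableOn_Ioo]
  refine Integrable.mono' (h.mono_set Ioo_subset_Ioc_self)
    (measurable_gegenbauerWeight n).aestronglyMeasurable ?_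
  filter_upwards [ae_restrict_mem measurableSet_Ioo] with t ht
  have h₁ : 0 < 1 - t ^ 2 := by nlinarith [ht.1, ht.2]
  rw [Real.norm_of_nonneg (gegenbauerWeight_pos n ht).le, one_div, Real.sqrt_eq_rpow,
    ← Real.rpow_neg h₁.le, gegenbauerWeight]
  refine Real.rpow_le_rpow_of_exponent_ge h₁ (by nlinarith [sq_nonneg t]) ?_
  have : (2 : ℝ) ≤ n := by exact_mod_cast hn
  linarith

/-- The measure `(1 - t ^ 2) ^ ((n - 3) / 2) dt` on `[-1, 1]`. -/
noncomputable def gegenbauerMeasure (n : ℕ) : Measure ℝ :=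
  (volume.restrict (Icc (-1) 1)).withDensity fun t => ENNReal.ofReal (gegenbauerWeight n t)

theorem gegenbauerMeasure_restrict (n : ℕ) :
    (gegenbauerMeasure n).restrict (Icc (-1) 1) = gegenbauerMeasure n := by
  rw [gegenbauerMeasure, restrict_withDensity measurableSet_Icc,
    Measure.restrict_restrict measurableSet_Icc, inter_self]

theorem isFiniteMeasure_gegenbauerMeasure (hn : 2 ≤ n) : IsFiniteMeasure (gegenbauerMeasure n) :=
  isFiniteMeasure_withDensity_ofReal (integrableOn_gegenbauerWeight hn).2

theorem integral_gegenbauerMeasure (n : ℕ) (g : ℝ → ℝ) :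
    ∫ t, g t ∂gegenbauerMeasure n = ∫ t in (-1 : ℝ)..1, g t * gegenbauerWeight n t := by
  rw [gegenbauerMeasure, integral_withDensity_eq_integral_toReal_smul
    (measurable_gegenbauerWeight n).ennreal_ofReal (by simp),
    intervalIntegral.integral_of_le (by norm_num), ← integral_Icc_eq_integral_Ioc]
  refine setIntegral_congr_fun measurableSet_Icc fun t ht => ?_
  simp only [ENNReal.toReal_ofReal (gegenbauerWeight_nonneg n ht), smul_eq_mul]
  ring

theorem gegenbauerCoeff_eq (n : ℕ) (f : ℝ → ℝ) (k : ℕ) :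
    gegenbauerCoeff n f k = (∫ t, f t * (gegenbauerPoly n k).eval t ∂gegenbauerMeasure n) /
      ∫ t, ((gegenbauerPoly n k).eval t) ^ 2 ∂gegenbauerMeasure n := by
  rw [gegenbauerCoeff, integral_gegenbauerMeasure, integral_gegenbauerMeasure]

theorem integrable_gegenbauerMeasure (hn : 2 ≤ n) {g : ℝ → ℝ} (hg : ContinuousOn g (Icc (-1) 1)) :
    Integrable g (gegenbauerMeasure n) := by
  have := isFiniteMeasure_gegenbauerMeasure hn
  rw [← gegenbauerMeasure_restrict]
  exact hg.integrableOn_compact isCompact_Icc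

/-- Required by the peak-function limit, also at the endpoints: every neighbourhood of a point of
`[-1, 1]` meets the open interval, where the weight is positive. -/
theorem gegenbauerMeasure_inter_pos (n : ℕ) {u : Set ℝ} (hu : IsOpen u) {x : ℝ} (hxu : x ∈ u)
    (hx : x ∈ Icc (-1 : ℝ) 1) : 0 < gegenbauerMeasure n (u ∩ Icc (-1) 1) := by
  have hne : (u ∩ Ioo (-1 : ℝ) 1).Nonempty := by
    rw [← closure_Ioo (by norm_num)] at hx
    exact mem_closure_iff.1 hx u hu hxu
  have hopen := hu.inter (isOpen_Ioo (a := (-1 : ℝ)) (b := 1))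
  refine lt_of_lt_of_le ?_ (measure_mono (inter_subset_inter_right u Ioo_subset_Icc_self))
  rw [pos_iff_ne_zero, gegenbauerMeasure, Ne, withDensity_apply _ hopen.measurableSet,
    Measure.restrict_restrict hopen.measurableSet,
    setLIntegral_eq_zero_iff (hopen.measurableSet.inter measurableSet_Icc)
      (measurable_gegenbauerWeight n).ennreal_ofReal]
  intro h
  have h₂ : volume (u ∩ Ioo (-1 : ℝ) 1) = 0 := by
    refine measure_mono_null ?_ h
    intro t ht
    simp only [mem_ofPred_eq, mem_compl_iff, not_forall]
    exact ⟨⟨ht, Ioo_subset_Icc_self ht.2⟩, by simpa using gegenbauerWeight_pos n ht.2⟩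
  exact (hopen.measure_pos volume hne).ne' h₂

/-- Integration by parts against the Gegenbauer weight. -/
theorem integral_one_sub_sq_mul_derivative (hn : 2 ≤ n) (p : ℝ[X]) :
    ∫ t, (1 - t ^ 2) * p.derivative.eval t ∂gegenbauerMeasure n =
      ((n : ℝ) - 1) * ∫ t, t * p.eval t ∂gegenbauerMeasure n := by
  have hn' : (2 : ℝ) ≤ n := by exact_mod_cast hn
  have he : 0 < ((n : ℝ) - 1) / 2 := by linarith
  have hcont : Continuous fun t : ℝ => (1 - t ^ 2) * p.derivative.eval t -
      ((n : ℝ) - 1) * (t * p.eval t) := by fun_prop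
  -- The primitive `(1 - t²)^((n-1)/2) p(t)` vanishes at `±1` because its exponent is positive. Its
  -- derivative is needed only in the interior, as the weight is singular at the endpoints for `n =
  -- 2`.
  have hderiv (t : ℝ) (ht : t ∈ Ioo (-1 : ℝ) 1) :
      HasDerivAt (fun t : ℝ => (1 - t ^ 2) ^ (((n : ℝ) - 1) / 2) * p.eval t)
        (((1 - t ^ 2) * p.derivative.eval t - ((n : ℝ) - 1) * (t * p.eval t)) *
          gegenbauerWeight n t) t := by
    have h₁ : 0 < 1 - t ^ 2 := by nlinarith [ht.1, ht.2]
    have hd : HasDerivAt (fun t : ℝ => 1 - t ^ 2) (-(2 * t)) t := by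
      simpa using (hasDerivAt_pow 2 t).const_sub 1
    refine ((hd.rpow_const (p := ((n : ℝ) - 1) / 2) (Or.inl h₁.ne')).mul
      (p.hasDerivAt t)).congr_deriv ?_
    have e₁ : (1 - t ^ 2) ^ (((n : ℝ) - 1) / 2 - 1) = gegenbauerWeight n t := by
      rw [gegenbauerWeight]; congr 1; ring
    have e₂ : (1 - t ^ 2) ^ (((n : ℝ) - 1) / 2) = gegenbauerWeight n t * (1 - t ^ 2) := by
      rw [← e₁, ← Real.rpow_add_one h₁.ne']; congr 1; ring
    rw [e₁, e₂]
    ring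
  have h := intervalIntegral.integral_eq_sub_of_hasDerivAt_of_le (by norm_num : (-1 : ℝ) ≤ 1)
    (ContinuousOn.mul (ContinuousOn.rpow_const (by fun_prop) fun _ _ => Or.inr he.le)
      p.continuous.continuousOn) hderiv (by
      rw [intervalIntegrable_iff_integrableOn_Icc_of_le (by norm_num)]
      exact (integrableOn_gegenbauerWeight hn).continuousOn_mul hcont.continuousOn isCompact_Icc)
  rw [← integral_gegenbauerMeasure, integral_sub (integrable_gegenbauerMeasure hn (by fun_prop))
    (integrable_gegenbauerMeasure hn (by fun_prop)), integral_const_mul] at h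
  simp only [Pi.mul_apply, one_pow, sub_self, even_two, Even.neg_pow, Real.zero_rpow he.ne',
    zero_mul] at h
  linarith

/-! ### Orthogonality -/

theorem integral_C_mul_eval (n : ℕ) (a : ℝ) (p : ℝ[X]) :
    ∫ t, (C a * p).eval t ∂gegenbauerMeasure n = a * ∫ t, p.eval t ∂gegenbauerMeasure n := by
  simp only [eval_mul, eval_C, integral_const_mul]

theorem integral_sub_eval (hn : 2 ≤ n) (p q : ℝ[X]) :
    ∫ t, (p - q).eval t ∂gegenbauerMeasure n =
      ∫ t, p.eval t ∂gegenbauerMeasure n - ∫ t, q.eval t ∂gegenbauerMeasure n := by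
  simp only [eval_sub]
  exact integral_sub (integrable_gegenbauerMeasure hn p.continuous.continuousOn)
    (integrable_gegenbauerMeasure hn q.continuous.continuousOn)

theorem integral_add_eval (hn : 2 ≤ n) (p q : ℝ[X]) :
    ∫ t, (p + q).eval t ∂gegenbauerMeasure n =
      ∫ t, p.eval t ∂gegenbauerMeasure n + ∫ t, q.eval t ∂gegenbauerMeasure n := by
  simp only [eval_add]
  exact integral_add (integrable_gegenbauerMeasure hn p.continuous.continuousOn)
    (integrable_gegenbauerMeasure hn q.continuous.continuousOn)

/-- Integration by parts gives `(j + 1) ∫ P_j = (n + j) ∫ t P_{j+1}`. Combined with the integrated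
recurrence, this passes from `∫ P_j = 0` to `∫ P_{j+2} = 0`; for `j = 0` the two terms cancel. -/
theorem integral_gegenbauerPoly (hn : 2 ≤ n) (k : ℕ) :
    ∫ t, (gegenbauerPoly n (k + 1)).eval t ∂gegenbauerMeasure n = 0 := by
  have hn' : (2 : ℝ) ≤ n := by exact_mod_cast hn
  have key (j : ℕ) : ((j : ℝ) + 1) * ∫ t, (gegenbauerPoly n j).eval t ∂gegenbauerMeasure n =
      ((n : ℝ) + j) *
        ∫ t, (X * gegenbauerPoly n (j + 1)).eval t ∂gegenbauerMeasure n := by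
    have h₁ := integral_one_sub_sq_mul_derivative hn (gegenbauerPoly n (j + 1))
    have h₂ : ∫ t, (1 - t ^ 2) * (gegenbauerPoly n (j + 1)).derivative.eval t
        ∂gegenbauerMeasure n =
        ∫ t, (C ((j : ℝ) + 1) * (gegenbauerPoly n j - X * gegenbauerPoly n (j + 1))).eval t
          ∂gegenbauerMeasure n := by
      rw [← one_sub_sq_mul_derivative_gegenbauerPoly hn]
      simp
    have h₃ : ∫ t, t * (gegenbauerPoly n (j + 1)).eval t ∂gegenbauerMeasure n =
        ∫ t, (X * gegenbauerPoly n (j + 1)).eval t ∂gegenbauerMeasure n := by simp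
    rw [h₂, h₃, integral_C_mul_eval, integral_sub_eval hn] at h₁
    linarith
  have hrec (j : ℕ) := congrArg (fun p : ℝ[X] => ∫ t, p.eval t ∂gegenbauerMeasure n)
    (gegenbauerPoly_recurrence hn j)
  simp only [integral_sub_eval hn, mul_assoc, integral_C_mul_eval] at hrec
  induction k using Nat.twoStepInduction with
  | zero =>
    have h := integral_one_sub_sq_mul_derivative hn 1
    simp only [derivative_one, eval_zero, mul_zero, integral_zero, eval_one, mul_one] at h
    have h' := (mul_eq_zero.1 h.symm).resolve_left (by linarith)
    simpa [gegenbauerPoly] using h'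
  | one =>
    have h₁ := hrec 0
    have h₂ := key 0
    have h₃ : (((0 : ℕ) : ℝ) + 1 + n - 2) *
        ∫ t, (gegenbauerPoly n (0 + 2)).eval t ∂gegenbauerMeasure n = 0 := by
      rw [h₁]
      push_cast at h₂ ⊢
      linarith
    exact (mul_eq_zero.1 h₃).resolve_left (add_one_add_sub_two_pos hn 0).ne'
  | more j ih₀ _ =>
    have h₁ := hrec (j + 1)
    have h₂ := key (j + 1)
    rw [ih₀, mul_zero] at h₂
    have hpos : (0 : ℝ) < n + (j + 1 : ℕ) := by positivity
    rw [(mul_eq_zero.1 h₂.symm).resolve_left hpos.ne', ih₀, mul_zero, mul_zero, sub_zero] at h₁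
    exact (mul_eq_zero.1 h₁).resolve_left (add_one_add_sub_two_pos hn (j + 1)).ne'

theorem integral_gegenbauerPoly_mul_of_lt (hn : 2 ≤ n) {j k : ℕ} (h : j < k) :
    ∫ t, (gegenbauerPoly n k * gegenbauerPoly n j).eval t ∂gegenbauerMeasure n = 0 := by
  induction j using Nat.strong_induction_on generalizing k with
  | _ j ih =>
    cases j with
    | zero =>
      obtain ⟨k, rfl⟩ := Nat.exists_eq_succ_of_ne_zero h.ne'
      simpa [gegenbauerPoly] using integral_gegenbauerPoly hn k
    | succ j =>
      obtain ⟨a, b, ha, -, hb, hj⟩ := exists_X_mul_gegenbauerPoly hn j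
      obtain ⟨a', b', -, -, -, hk⟩ := exists_X_mul_gegenbauerPoly hn k
      -- Expand `t P_k P_j` in two ways; all products except `P_k P_{j+1}` have smaller lower index
      -- and integrate to zero by induction.
      have e : C a * (gegenbauerPoly n k * gegenbauerPoly n (j + 1)) +
          C b * (gegenbauerPoly n k * gegenbauerPoly n (j - 1)) =
          C a' * (gegenbauerPoly n (k + 1) * gegenbauerPoly n j) +
          C b' * (gegenbauerPoly n (k - 1) * gegenbauerPoly n j) := by
        linear_combination gegenbauerPoly n j * hk - gegenbauerPoly n k * hj
      have := congrArg (fun p : ℝ[X] => ∫ t, p.eval t ∂gegenbauerMeasure n) e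
      simp only [integral_add_eval hn, integral_C_mul_eval] at this
      rw [ih (j - 1) (by omega) (by omega), ih j (by omega) (k := k + 1) (by omega),
        ih j (by omega) (k := k - 1) (by omega)] at this
      simpa [ha.ne'] using this

/-- Orthogonality of the Gegenbauer polynomials. -/
theorem integral_gegenbauerPoly_mul_of_ne (hn : 2 ≤ n) {j k : ℕ} (h : j ≠ k) :
    ∫ t, (gegenbauerPoly n j * gegenbauerPoly n k).eval t ∂gegenbauerMeasure n = 0 := by
  rcases h.lt_or_gt with h | h
  · rw [mul_comm]
    exact integral_gegenbauerPoly_mul_of_lt hn h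
  · exact integral_gegenbauerPoly_mul_of_lt hn h

/-- Integrating `t P_k P_{k+1}` in two ways and dropping orthogonal terms gives `a ∫ P_{k+1}² = b' ∫
P_k²` with `a, b' > 0`. -/
theorem integral_gegenbauerPoly_sq_pos (hn : 2 ≤ n) (k : ℕ) :
    0 < ∫ t, ((gegenbauerPoly n k).eval t) ^ 2 ∂gegenbauerMeasure n := by
  have := isFiniteMeasure_gegenbauerMeasure hn
  induction k with
  | zero =>
    have h := gegenbauerMeasure_inter_pos n isOpen_univ (mem_univ 0) (by constructor <;> norm_num)
    have h' : gegenbauerMeasure n univ ≠ 0 :=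
      (lt_of_lt_of_le h (measure_mono (subset_univ _))).ne'
    simp only [gegenbauerPoly, eval_one, one_pow, integral_const, smul_eq_mul, mul_one]
    exact ENNReal.toReal_pos h' (measure_ne_top _ _)
  | succ k ih =>
    obtain ⟨a, b, ha, -, -, hk⟩ := exists_X_mul_gegenbauerPoly hn k
    obtain ⟨a', b', -, -, hb', hk'⟩ := exists_X_mul_gegenbauerPoly hn (k + 1)
    have e : C a * (gegenbauerPoly n (k + 1) * gegenbauerPoly n (k + 1)) +
        C b * (gegenbauerPoly n (k + 1) * gegenbauerPoly n (k - 1)) =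
        C a' * (gegenbauerPoly n (k + 2) * gegenbauerPoly n k) +
        C b' * (gegenbauerPoly n k * gegenbauerPoly n k) := by
      rw [Nat.add_sub_cancel] at hk'
      linear_combination gegenbauerPoly n k * hk' - gegenbauerPoly n (k + 1) * hk
    have h := congrArg (fun p : ℝ[X] => ∫ t, p.eval t ∂gegenbauerMeasure n) e
    simp only [integral_add_eval hn, integral_C_mul_eval] at h
    rw [integral_gegenbauerPoly_mul_of_ne hn (by omega : k + 1 ≠ k - 1),
      integral_gegenbauerPoly_mul_of_ne hn (by omega : k + 2 ≠ k)] at h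
    simp only [← sq, eval_pow] at h
    have := mul_pos (hb' k.succ_pos) ih
    exact pos_of_mul_pos_right (a := a) (by linarith) ha.le

end GegenbauerMeasure

/-! ### Convergence of the Gegenbauer expansion -/

section GegenbauerExpansion

open MeasureTheory Set Polynomial Filter Topology

variable {n : ℕ}

/-- The normalized powers `c^k / ∫ c^k` concentrate at the unique maximum `x`, so the weighted
averages of `g` tend to `g x`. -/
theorem nonneg_of_integral_mul_pow_nonneg (hn : 2 ≤ n) {g c : ℝ → ℝ}
    (hg : ContinuousOn g (Icc (-1) 1)) (hc : Continuous c) {x : ℝ} (hx : x ∈ Icc (-1 : ℝ) 1)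
    (hcx : ∀ y ∈ Icc (-1 : ℝ) 1, y ≠ x → c y < c x) (hc₀ : ∀ y ∈ Icc (-1 : ℝ) 1, 0 ≤ c y)
    (hx₀ : 0 < c x) (h : ∀ k : ℕ, 0 ≤ ∫ t, c t ^ k * g t ∂gegenbauerMeasure n) : 0 ≤ g x := by
  have := isFiniteMeasure_gegenbauerMeasure hn
  have hlim := tendsto_setIntegral_pow_smul_of_unique_maximum_of_isCompact_of_measure_nhdsWithin_pos
    (μ := gegenbauerMeasure n) isCompact_Icc
    (fun u hu hxu => gegenbauerMeasure_inter_pos n hu hxu hx) hc.continuousOn hcx hc₀ hx₀ hx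
    (integrable_gegenbauerMeasure hn hg).integrableOn (hg x hx)
  refine ge_of_tendsto' hlim fun k => ?_
  refine mul_nonneg (inv_nonneg.2 ?_) ?_
  · exact setIntegral_nonneg measurableSet_Icc fun t ht => pow_nonneg (hc₀ t ht) k
  · rw [gegenbauerMeasure_restrict]
    exact h k

/-- A continuous function on `[-1, 1]` with nonnegative Gegenbauer coefficients is nonnegative
at `1`. -/
theorem nonneg_eval_one_of_integral_nonneg (hn : 2 ≤ n) {g : ℝ → ℝ}
    (hg : ContinuousOn g (Icc (-1) 1))
    (h : ∀ i, 0 ≤ ∫ t, g t * (gegenbauerPoly n i).eval t ∂gegenbauerMeasure n) : 0 ≤ g 1 := by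
  -- Multiplication by `(1 + t) / 2`, which peaks at `1`, preserves nonnegativity of all
  -- coefficients because the recurrence for `t P_i` has nonnegative coefficients.
  have key (k : ℕ) : ∀ i, 0 ≤ ∫ t, ((1 + t) / 2) ^ k * g t * (gegenbauerPoly n i).eval t
      ∂gegenbauerMeasure n := by
    induction k with
    | zero => simpa using h
    | succ k ih =>
      intro i
      obtain ⟨a, b, ha, hb, -, hi⟩ := exists_X_mul_gegenbauerPoly hn i
      have hint (j : ℕ) : Integrable (fun t => ((1 + t) / 2) ^ k * g t *
          (gegenbauerPoly n j).eval t) (gegenbauerMeasure n) :=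
        integrable_gegenbauerMeasure hn (by fun_prop)
      have e : (fun t => ((1 + t) / 2) ^ (k + 1) * g t * (gegenbauerPoly n i).eval t) = fun t =>
          (1 / 2) * (((1 + t) / 2) ^ k * g t * (gegenbauerPoly n i).eval t) +
          (a / 2 * (((1 + t) / 2) ^ k * g t * (gegenbauerPoly n (i + 1)).eval t) +
          b / 2 * (((1 + t) / 2) ^ k * g t * (gegenbauerPoly n (i - 1)).eval t)) := by
        ext t
        have := congrArg (eval t) hi
        simp only [eval_mul, eval_X, eval_add, eval_C] at this
        linear_combination (((1 + t) / 2) ^ k * g t) / 2 * this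
      rw [e, integral_add (integrable_gegenbauerMeasure hn (by fun_prop))
        (integrable_gegenbauerMeasure hn (by fun_prop)),
        integral_add ((hint _).const_mul _) ((hint _).const_mul _), integral_const_mul,
        integral_const_mul, integral_const_mul]
      have h₁ := ih i
      have h₂ := mul_nonneg ha.le (ih (i + 1))
      have h₃ := mul_nonneg hb (ih (i - 1))
      linarith
  refine nonneg_of_integral_mul_pow_nonneg hn (c := fun t => (1 + t) / 2) hg (by fun_prop)
    (by simp) (fun y hy hne => ?_) (fun y hy => ?_) (by norm_num) fun k => ?_
  · have := lt_of_le_of_ne hy.2 hne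
    linarith
  · linarith [hy.1]
  · simpa [gegenbauerPoly] using key k 0

/-- A continuous function on `[-1, 1]` with vanishing Gegenbauer coefficients vanishes. -/
theorem eq_zero_of_integral_eq_zero (hn : 2 ≤ n) {g : ℝ → ℝ} (hg : ContinuousOn g (Icc (-1) 1))
    (h : ∀ i, ∫ t, g t * (gegenbauerPoly n i).eval t ∂gegenbauerMeasure n = 0)
    {x : ℝ} (hx : x ∈ Icc (-1 : ℝ) 1) : g x = 0 := by
  have key (p : ℝ[X]) : ∀ i, ∫ t, g t * (p * gegenbauerPoly n i).eval t
      ∂gegenbauerMeasure n = 0 := by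
    induction p using Polynomial.induction_on with
    | C a =>
      intro i
      simp only [eval_mul, eval_C, mul_left_comm _ a, integral_const_mul, h, mul_zero]
    | add p q hp hq =>
      intro i
      simp only [add_mul, eval_add, mul_add]
      rw [integral_add (integrable_gegenbauerMeasure hn (by fun_prop))
        (integrable_gegenbauerMeasure hn (by fun_prop)), hp, hq, add_zero]
    | monomial k a hk =>
      intro i
      obtain ⟨b, c, -, -, -, hi⟩ := exists_X_mul_gegenbauerPoly hn i
      have e : C a * X ^ (k + 1) * gegenbauerPoly n i =
          C b * (C a * X ^ k * gegenbauerPoly n (i + 1)) +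
          C c * (C a * X ^ k * gegenbauerPoly n (i - 1)) := by
        linear_combination C a * X ^ k * hi
      simp only [e, eval_add, eval_mul (p := C b), eval_mul (p := C c), eval_C, mul_add,
        mul_left_comm _ b, mul_left_comm _ c]
      rw [integral_add (integrable_gegenbauerMeasure hn (by fun_prop))
        (integrable_gegenbauerMeasure hn (by fun_prop)), integral_const_mul, integral_const_mul,
        hk, hk, mul_zero, mul_zero, add_zero]
  -- A polynomial peak at `x`: since `|t - x| ≤ 2` on `[-1, 1]`, it takes values in `[0, 1]` there
  -- and equals `1` only at `x`.
  have key' (k : ℕ) : ∫ t, (1 - (t - x) ^ 2 / 4) ^ k * g t ∂gegenbauerMeasure n = 0 := by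
    have := key ((1 - C (1 / 4) * (X - C x) ^ 2) ^ k) 0
    rw [← this]
    congr 1
    ext t
    simp [gegenbauerPoly]
    ring
  have hpos {g' : ℝ → ℝ} (hg' : ContinuousOn g' (Icc (-1) 1))
      (h' : ∀ k : ℕ, 0 ≤ ∫ t, (1 - (t - x) ^ 2 / 4) ^ k * g' t ∂gegenbauerMeasure n) :
      0 ≤ g' x := by
    refine nonneg_of_integral_mul_pow_nonneg hn (c := fun t => 1 - (t - x) ^ 2 / 4) hg'
      (by fun_prop) hx (fun y hy hne => ?_) (fun y hy => ?_) (by norm_num) h'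
    · have := sq_pos_of_ne_zero (sub_ne_zero.2 hne)
      simp only [sub_self]
      linarith
    · nlinarith [hy.1, hy.2, hx.1, hx.2]
  refine le_antisymm ?_ (hpos hg fun k => (key' k).ge)
  have := hpos (g' := fun t => -g t) hg.neg fun k => by
    simp only [mul_neg, integral_neg, key' k, neg_zero, le_refl]
  linarith

theorem integral_mul_gegenbauerPoly (hn : 2 ≤ n) (f : ℝ → ℝ) (i : ℕ) :
    ∫ t, f t * (gegenbauerPoly n i).eval t ∂gegenbauerMeasure n = gegenbauerCoeff n f i *
      ∫ t, ((gegenbauerPoly n i).eval t) ^ 2 ∂gegenbauerMeasure n := by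
  rw [gegenbauerCoeff_eq, div_mul_cancel₀ _ (integral_gegenbauerPoly_sq_pos hn i).ne']

theorem integral_gegenbauerPoly_mul (hn : 2 ≤ n) (i j : ℕ) :
    ∫ t, (gegenbauerPoly n i).eval t * (gegenbauerPoly n j).eval t ∂gegenbauerMeasure n =
      if i = j then ∫ t, ((gegenbauerPoly n j).eval t) ^ 2 ∂gegenbauerMeasure n else 0 := by
  split_ifs with h
  · subst h
    simp only [sq]
  · simpa using integral_gegenbauerPoly_mul_of_ne hn h

/-- The difference `∑_{i≤N} f_i P_i - f` has coefficients `0` up to `N` and `-f_i ≥ 0` beyond.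
Nonnegativity at `1` gives `∑_{1≤i≤N} (-f_i) ≤ f_0 - f(1)` uniformly in `N`. -/
theorem summable_gegenbauerCoeff (hn : 2 ≤ n) {f : ℝ → ℝ} (hf : ContinuousOn f (Icc (-1) 1))
    (hc : ∀ i, 1 ≤ i → gegenbauerCoeff n f i ≤ 0) : Summable (gegenbauerCoeff n f) := by
  have hsum (N : ℕ) : 0 ≤ -f 1 + ∑ i ∈ Finset.range (N + 1), gegenbauerCoeff n f i := by
    have h := nonneg_eval_one_of_integral_nonneg hn (g := fun t => -f t +
      ∑ i ∈ Finset.range (N + 1), gegenbauerCoeff n f i * (gegenbauerPoly n i).eval t)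
      (by fun_prop) fun j => by
        have e : ∀ t, (-f t + ∑ i ∈ Finset.range (N + 1),
            gegenbauerCoeff n f i * (gegenbauerPoly n i).eval t) * (gegenbauerPoly n j).eval t =
            -(f t * (gegenbauerPoly n j).eval t) + ∑ i ∈ Finset.range (N + 1),
              gegenbauerCoeff n f i *
                ((gegenbauerPoly n i).eval t * (gegenbauerPoly n j).eval t) := by
          intro t
          rw [add_mul, Finset.sum_mul, neg_mul]
          simp only [mul_assoc]
        simp only [e]
        rw [integral_add (integrable_gegenbauerMeasure hn (by fun_prop))
          (integrable_gegenbauerMeasure hn (by fun_prop)), integral_neg,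
          integral_finsetSum _ fun i _ => integrable_gegenbauerMeasure hn (by fun_prop)]
        simp only [integral_const_mul, integral_gegenbauerPoly_mul hn,
          integral_mul_gegenbauerPoly hn, mul_ite, mul_zero, Finset.sum_ite_eq']
        split_ifs with hj
        · simp
        · have h₁ : 1 ≤ j := by
            rw [Finset.mem_range] at hj
            omega
          have := mul_nonneg (neg_nonneg.2 (hc j h₁)) (integral_gegenbauerPoly_sq_pos hn j).le
          linarith
    simpa [gegenbauerPoly_eval_one hn] using h
  rw [← summable_nat_add_iff 1, ← summable_neg_iff]
  refine summable_of_sum_range_le (c := gegenbauerCoeff n f 0 - f 1)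
    (fun i => neg_nonneg.2 (hc _ i.succ_pos)) fun N => ?_
  have h := hsum N
  rw [Finset.sum_range_succ'] at h
  simp only [Finset.sum_neg_distrib]
  linarith

/-- A continuous function on `[-1, 1]` whose Gegenbauer coefficients of positive degree are
nonpositive is the sum of its Gegenbauer expansion. -/
theorem hasSum_gegenbauerCoeff (hn : 2 ≤ n) {f : ℝ → ℝ} (hf : ContinuousOn f (Icc (-1) 1))
    (hc : ∀ i, 1 ≤ i → gegenbauerCoeff n f i ≤ 0) {x : ℝ} (hx : x ∈ Icc (-1 : ℝ) 1) :
    HasSum (fun i => gegenbauerCoeff n f i * (gegenbauerPoly n i).eval x) (f x) := by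
  have := isFiniteMeasure_gegenbauerMeasure hn
  have hs := (summable_gegenbauerCoeff hn hf hc).abs
  have hbound (i : ℕ) (t : ℝ) (ht : t ∈ Icc (-1 : ℝ) 1) :
      ‖gegenbauerCoeff n f i * (gegenbauerPoly n i).eval t‖ ≤ |gegenbauerCoeff n f i| := by
    rw [norm_mul, Real.norm_eq_abs, Real.norm_eq_abs]
    exact mul_le_of_le_one_right (abs_nonneg _) (abs_gegenbauerPoly_eval_le_one hn i ht)
  have hcont : ContinuousOn
      (fun t => ∑' i, gegenbauerCoeff n f i * (gegenbauerPoly n i).eval t) (Icc (-1) 1) :=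
    continuousOn_tsum (fun i => by fun_prop) hs hbound
  have hsx := Summable.of_norm_bounded hs fun i => hbound i x hx
  -- Termwise integration, justified by absolute summability, shows that `f` minus its series has
  -- all coefficients zero.
  have hzero := eq_zero_of_integral_eq_zero hn (g := fun t => f t -
    ∑' i, gegenbauerCoeff n f i * (gegenbauerPoly n i).eval t) (hf.sub hcont) (fun j => by
      simp only [sub_mul]
      rw [integral_sub (integrable_gegenbauerMeasure hn (by fun_prop))
        (integrable_gegenbauerMeasure hn (by fun_prop)), integral_mul_gegenbauerPoly hn]
      simp only [← tsum_mul_right]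
      rw [← (hasSum_integral_of_summable_integral_norm
        (fun i => integrable_gegenbauerMeasure hn (by fun_prop)) ?_).tsum_eq]
      · simp only [mul_assoc, integral_const_mul, integral_gegenbauerPoly_mul hn, mul_ite,
          mul_zero, tsum_ite_eq, sub_self]
      · refine Summable.of_nonneg_of_le (fun i => integral_nonneg fun t => norm_nonneg _)
          (fun i => ?_) (hs.mul_right ((gegenbauerMeasure n).real univ))
        have hle : ∀ᵐ t ∂gegenbauerMeasure n, ‖gegenbauerCoeff n f i *
            (gegenbauerPoly n i).eval t * (gegenbauerPoly n j).eval t‖ ≤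
            |gegenbauerCoeff n f i| := by
          rw [← gegenbauerMeasure_restrict]
          filter_upwards [ae_restrict_mem measurableSet_Icc] with t ht
          rw [norm_mul]
          exact (mul_le_of_le_one_right (norm_nonneg _)
            (abs_gegenbauerPoly_eval_le_one hn j ht)).trans (hbound i t ht)
        refine (integral_mono_ae (integrable_gegenbauerMeasure hn (by fun_prop)).norm
          (integrable_const _) hle).trans_eq ?_
        rw [integral_const, smul_eq_mul, mul_comm]) hx
  rw [sub_eq_zero.1 hzero]
  exact hsx.hasSum

end GegenbauerExpansion

/-! ### Energy bound and equality case -/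

section Energy

variable {n : ℕ}

theorem codeMoment_nonneg (hn : 2 ≤ n) {C : Finset (EuclideanSpace ℝ (Fin n))}
    (hC : ∀ x ∈ C, ‖x‖ = 1) (i : ℕ) : 0 ≤ codeMoment C i := by
  simpa [codeMoment] using gegenbauerPoly_posDef hn i C (fun _ => 1) id hC

theorem codeMoment_zero (C : Finset (EuclideanSpace ℝ (Fin n))) :
    codeMoment C 0 = (C.card : ℝ) ^ 2 := by
  simp [codeMoment, gegenbauerPoly, sq]

theorem inner_mem_Icc {x y : EuclideanSpace ℝ (Fin n)} (hx : ‖x‖ = 1) (hy : ‖y‖ = 1) :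
    inner ℝ x y ∈ Set.Icc (-1 : ℝ) 1 := by
  have := abs_real_inner_le_norm x y
  rw [hx, hy, mul_one, abs_le] at this
  exact this

theorem sum_sum_inner_eq_hEnergy (f : ℝ → ℝ) {C : Finset (EuclideanSpace ℝ (Fin n))}
    (hC : ∀ x ∈ C, ‖x‖ = 1) :
    ∑ x ∈ C, ∑ y ∈ C, f (inner ℝ x y) = hEnergy f C + C.card * f 1 := by
  classical
  rw [← Finset.sum_product', ← Finset.diag_union_offDiag,
    Finset.sum_union (Finset.disjoint_diag_offDiag C), Finset.sum_diag, add_comm]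
  congr 1
  rw [Finset.sum_congr rfl fun x hx => by rw [real_inner_self_eq_norm_sq, hC x hx, one_pow],
    Finset.sum_const, nsmul_eq_mul]

/-- Sum the pointwise expansion over all pairs, then move the degree `0` term, where the moment is
`|C|²`, to the other side. -/
theorem hasSum_codeMoment (hn : 2 ≤ n) {f : ℝ → ℝ} (hf : ContinuousOn f (Set.Icc (-1) 1))
    (hc : ∀ i, 1 ≤ i → gegenbauerCoeff n f i ≤ 0) {C : Finset (EuclideanSpace ℝ (Fin n))}
    (hC : ∀ x ∈ C, ‖x‖ = 1) :
    HasSum (fun i => gegenbauerCoeff n f (i + 1) * codeMoment C (i + 1))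
      (hEnergy f C + C.card * f 1 - gegenbauerCoeff n f 0 * (C.card : ℝ) ^ 2) := by
  have h : HasSum (fun i => gegenbauerCoeff n f i * codeMoment C i)
      (∑ x ∈ C, ∑ y ∈ C, f (inner ℝ x y)) := by
    simp only [codeMoment, Finset.mul_sum]
    exact hasSum_sum fun x hx => hasSum_sum fun y hy =>
      hasSum_gegenbauerCoeff hn hf hc (inner_mem_Icc (hC x hx) (hC y hy))
  rw [sum_sum_inner_eq_hEnergy f hC] at h
  rw [hasSum_nat_add_iff (f := fun i => gegenbauerCoeff n f i * codeMoment C i) 1]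
  simpa [codeMoment_zero] using h

/-- The universal upper bound for the `h`-energy of a spherical code, with its equality case. -/
theorem hEnergy_le_and_eq_iff (hn : 2 ≤ n) {M : ℕ} {s : ℝ} {h f : ℝ → ℝ}
    (hf : f ∈ feasibleSet h n s) {C : Finset (EuclideanSpace ℝ (Fin n))}
    (hC : C ∈ sphericalCodes n M s) :
    hEnergy h C ≤ M * (gegenbauerCoeff n f 0 * M - f 1) ∧
      (hEnergy h C = M * (gegenbauerCoeff n f 0 * M - f 1) ↔
        (∀ t ∈ innerProducts C, f t = h t) ∧
          ∀ i : ℕ, 1 ≤ i → gegenbauerCoeff n f i * codeMoment C i = 0) := by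
  classical
  obtain ⟨hcont, hfh, hc⟩ := hf
  obtain ⟨hsph, hcard, hgreat⟩ := hC
  have hnorm (x) (hx : x ∈ C) : ‖x‖ = 1 := by simpa using hsph x hx
  have hS := (hasSum_codeMoment hn hcont hc hnorm).neg
  have hterm (i : ℕ) : 0 ≤ -(gegenbauerCoeff n f (i + 1) * codeMoment C (i + 1)) :=
    neg_nonneg.2 (mul_nonpos_of_nonpos_of_nonneg (hc _ i.succ_pos) (codeMoment_nonneg hn hnorm _))
  have hle : ∀ p ∈ C.offDiag, h (inner ℝ p.1 p.2) ≤ f (inner ℝ p.1 p.2) := by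
    intro p hp
    rw [Finset.mem_offDiag] at hp
    exact hfh _ ⟨(inner_mem_Icc (hnorm _ hp.1) (hnorm _ hp.2.1)).1,
      hgreat.2 ⟨p.1, hp.1, p.2, hp.2.1, hp.2.2, rfl⟩⟩
  have h₁ : hEnergy h C ≤ hEnergy f C := by
    simp only [hEnergy]
    convert Finset.sum_le_sum hle
  have h₁' : hEnergy h C = hEnergy f C ↔ ∀ t ∈ innerProducts C, f t = h t := by
    have : hEnergy h C = hEnergy f C ↔
        ∀ p ∈ C.offDiag, h (inner ℝ p.1 p.2) = f (inner ℝ p.1 p.2) := by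
      simp only [hEnergy]
      convert Finset.sum_eq_sum_iff_of_le hle
    rw [this]
    constructor
    · rintro H t ⟨x, hx, y, hy, hxy, rfl⟩
      exact (H (x, y) (Finset.mem_offDiag.2 ⟨hx, hy, hxy⟩)).symm
    · intro H p hp
      rw [Finset.mem_offDiag] at hp
      exact (H _ ⟨p.1, hp.1, p.2, hp.2.1, hp.2.2, rfl⟩).symm
  rw [hcard] at hS
  have h₂ := hS.nonneg hterm
  have h₂' : -(hEnergy f C + M * f 1 - gegenbauerCoeff n f 0 * (M : ℝ) ^ 2) = 0 ↔
      ∀ i : ℕ, 1 ≤ i → gegenbauerCoeff n f i * codeMoment C i = 0 := by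
    constructor
    · intro H i hi
      rw [H, hasSum_zero_iff_of_nonneg hterm] at hS
      obtain ⟨j, rfl⟩ := Nat.exists_eq_add_of_le' hi
      exact neg_eq_zero.1 (congrFun hS j)
    · intro H
      refine hS.unique ?_
      simp [H]
  rw [← h₁', ← h₂']
  -- In the chain `E_h ≤ E_f ≤ M (f_0 M - f(1))`, equality of the ends is equality at both links.
  refine ⟨by linarith, fun H => ⟨by linarith, by linarith⟩, fun H => by linarith [H.1, H.2]⟩

end Energy

theorem mainTheorem2 (n M : ℕ) (hn : 2 ≤ n) (hM : 2 ≤ M)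
    (s : ℝ) (hs : s ∈ Set.Ico (-1 : ℝ) 1) (h : ℝ → ℝ)
    (f : ℝ → ℝ) (hf : f ∈ feasibleSet h n s)
    (C : Finset (EuclideanSpace ℝ (Fin n))) (hC : C ∈ sphericalCodes n M s) :
    ((hEnergy h C : ℝ) : EReal) ≤ maxEnergy h n M s ∧
    maxEnergy h n M s ≤ (((M : ℝ) * (gegenbauerCoeff n f 0 * M - f 1) : ℝ) : EReal) ∧
    ((((hEnergy h C : ℝ) : EReal) = maxEnergy h n M s ∧
        maxEnergy h n M s = (((M : ℝ) * (gegenbauerCoeff n f 0 * M - f 1) : ℝ) : EReal)) ↔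
      ((∀ t ∈ innerProducts C, f t = h t) ∧
        ∀ i : ℕ, 1 ≤ i → gegenbauerCoeff n f i * codeMoment C i = 0)) := by
  have hsup : maxEnergy h n M s ≤
      (((M : ℝ) * (gegenbauerCoeff n f 0 * M - f 1) : ℝ) : EReal) :=
    iSup₂_le fun C' hC' => EReal.coe_le_coe_iff.2 (hEnergy_le_and_eq_iff hn hf hC').1
  have hC_le : ((hEnergy h C : ℝ) : EReal) ≤ maxEnergy h n M s :=
    le_iSup₂ (f := fun C' (_ : C' ∈ sphericalCodes n M s) => ((hEnergy h C' : ℝ) : EReal)) C hC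
  refine ⟨hC_le, hsup, ?_⟩
  rw [← (hEnergy_le_and_eq_iff hn hf hC).2]
  constructor
  · rintro ⟨h₁, h₂⟩
    exact EReal.coe_eq_coe_iff.1 (h₁.trans h₂)
  · intro H
    rw [H] at hC_le ⊢
    exact ⟨le_antisymm hC_le hsup, le_antisymm hsup hC_le⟩
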